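/- Throughout, \emph{logic} means normal modal logic: a set of modal formulas over countably many propositional variables that contains all propositional tautologies and $\Box(p\to q)\to(\Box p\to\Box q)$ (with $\Box=\neg\Diamond\neg$, $\Diamond p\leftrightarrow\neg\Box\neg p$), closed under modus ponens, necessitation and uniform substitution (the set of all formulas included). For a logic $L_0$ and a set $\Gamma$ of formulas, $L_0+\Gamma$ is the least logic containing $L_0\cup\Gamma$, and $\mathrm{NExt}(L_0)$ is the complete lattice, ordered by inclusion, of all logics containing $L_0$. For $m\ge 1$ let $\mathsf{K4}^{m+1}_1=\mathsf{K}+\Diamond^{m+1}p\to\Diamond p$, where $\mathsf K$ is the least logic. An element $x$ of a complete lattice $X$ is a \emph{splitting} in $X$ if there is $y\in X$ with $x\not\le y$ such that every $z\in X$ satisfies $x\le z$ or $z\le y$. It is a \emph{union-splitting} if it is the join of a (possibly empty) set of splittings in $X$. A \emph{modal algebra} $\mathfrak A=(A,\Diamond)$ is a Boolean algebra $A$ with a unary operation such that $\Diamond 0=0$ and $\Diamond(a\vee b)=\Diamond a\vee\Diamond b$. It is a $\mathsf{K4}^{m+1}_1$-algebra if it validates $\mathsf{K4}^{m+1}_1$,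 and it is \emph{subdirectly irreducible} (s.i.) if among its congruences other than equality there is a least one (so a one-element algebra is not s.i.). For a finite s.i. $\mathsf{K4}^{m+1}_1$-algebra $\mathfrak A$, take pairwise distinct variables $p_a$ $(a\in A)$ and write $\Box^{\le m}\varphi=\varphi\wedge\Box\varphi\wedge\dots\wedge\Box^m\varphi$. The \emph{Jankov formula} of $\mathfrak A$ is $$\gamma^m(\mathfrak A,A)=\Box^{\le m}\bigwedge\Gamma\;\to\;\bigvee\{\Box^{\le m}p_a: a\in A,\ a\ne 1\},$$ where $$\Gamma=\{p_{a\vee b}\leftrightarrow p_a\vee p_b: a,b\in A\}\cup\{p_{\neg a}\leftrightarrow\neg p_a: a\in A\}\cup\{\Diamond p_a\to p_{\Diamond a}: a\in A\}\cup\{p_{\Diamond a}\to\Diamond p_a: a\in A\}.$$ \textbf{Theorem.} Let $m\ge 1$ and let $L\in\mathrm{NExt}(\mathsf{K4}^{m+1}_1)$. \begin{enumerate} \item $L$ is a splitting in $\mathrm{NExt}(\mathsf{K4}^{m+1}_1)$ if and only if $L=\mathsf{K4}^{m+1}_1+\gamma^m(\mathfrak A,A)$ for some finite s.i. $\mathsf{K4}^{m+1}_1$-algebra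 $\mathfrak A$. \item $L$ is a union-splitting in $\mathrm{NExt}(\mathsf{K4}^{m+1}_1)$ if and only if $L=\mathsf{K4}^{m+1}_1+\{\gamma^m(\mathfrak A_i,A_i): i\in I\}$ for some (possibly empty) set $\{\mathfrak A_i: i\in I\}$ of finite s.i. $\mathsf{K4}^{m+1}_1$-algebras. \end{enumerate} -/

import Mathlib

universe u

/-! ### Modal formulas -/

/-- Modal formulas over countably many propositional variables, with primitive
connectives `⊥`, `→`, `◇`. -/
inductive Formula : Type
  | var : ℕ → Formula
  | fls : Formula
  | imp : Formula → Formula → Formula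
  | dia : Formula → Formula

namespace Formula

def neg (φ : Formula) : Formula := φ.imp fls
def tru : Formula := neg fls
def or (φ ψ : Formula) : Formula := φ.neg.imp ψ
def and (φ ψ : Formula) : Formula := (φ.imp ψ.neg).neg
def iff (φ ψ : Formula) : Formula := (φ.imp ψ).and (ψ.imp φ)
def box (φ : Formula) : Formula := φ.neg.dia.neg

/-- `◇ⁿ φ`. -/
def diaPow : ℕ → Formula → Formula
  | 0, φ => φ
  | n + 1, φ => (diaPow n φ).dia

/-- `□ⁿ φ`. -/
def boxPow : ℕ → Formula → Formula
  | 0, φ => φ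
  | n + 1, φ => (boxPow n φ).box

/-- `□^{≤n} φ = φ ∧ □φ ∧ ⋯ ∧ □ⁿφ`. -/
def boxLe : ℕ → Formula → Formula
  | 0, φ => φ
  | n + 1, φ => (boxLe n φ).and (boxPow (n + 1) φ)

/-- Conjunction of a list of formulas (`⊤` for the empty list). -/
def listConj : List Formula → Formula
  | [] => tru
  | φ :: l => φ.and (listConj l)

/-- Disjunction of a list of formulas (`⊥` for the empty list). -/
def listDisj : List Formula → Formula
  | [] => fls
  | φ :: l => φ.or (listDisj l)

/-- Conjunction of a finite set of formulas. -/
noncomputable def conj (S : Finset Formula) : Formula := listConj S.toList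

/-- Disjunction of a finite set of formulas. -/
noncomputable def disj (S : Finset Formula) : Formula := listDisj S.toList

/-- Uniform substitution. -/
def subst (σ : ℕ → Formula) : Formula → Formula
  | var n => σ n
  | fls => fls
  | imp φ ψ => (subst σ φ).imp (subst σ ψ)
  | dia φ => (subst σ φ).dia

/-- `φ` is (a substitution instance of) a classical propositional tautology: it holds under every
truth assignment to formulas that respects `⊥` and `→`, formulas `◇ψ` being treated as atoms. -/
def IsTautology (φ : Formula) : Prop :=
  ∀ v : Formula → Prop, ¬ v fls → (∀ ψ χ, v (ψ.imp χ) ↔ (v ψ → v χ)) → v φ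

end Formula

/-! ### Normal modal logics -/

/-- A normal modal logic: a set of formulas containing all propositional tautologies,
`□(p → q) → (□p → □q)` and `◇p ↔ ¬□¬p`, and closed under modus ponens, necessitation and uniform
substitution. The inconsistent logic (all formulas) is included. -/
@[ext]
structure NormalLogic where
  carrier : Set Formula
  tautology_mem : ∀ φ : Formula, φ.IsTautology → φ ∈ carrier
  axiomK_mem : (((Formula.var 0).imp (Formula.var 1)).box.imp
    ((Formula.var 0).box.imp (Formula.var 1).box)) ∈ carrier
  dual_mem : ((Formula.var 0).dia.iff (Formula.var 0).neg.box.neg) ∈ carrier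
  mp_mem : ∀ φ ψ : Formula, φ.imp ψ ∈ carrier → φ ∈ carrier → ψ ∈ carrier
  nec_mem : ∀ φ : Formula, φ ∈ carrier → φ.box ∈ carrier
  subst_mem : ∀ (σ : ℕ → Formula) (φ : Formula), φ ∈ carrier → φ.subst σ ∈ carrier

namespace NormalLogic

/-- Logics are ordered by inclusion. -/
instance : PartialOrder NormalLogic := PartialOrder.lift carrier fun _ _ h => NormalLogic.ext h

/-- The meet of a set of logics is their intersection. -/
instance : InfSet NormalLogic where
  sInf S :=
    { carrier := {φ | ∀ L ∈ S, φ ∈ L.carrier}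
      tautology_mem := fun φ h L _ => L.tautology_mem φ h
      axiomK_mem := fun L _ => L.axiomK_mem
      dual_mem := fun L _ => L.dual_mem
      mp_mem := fun φ ψ h₁ h₂ L hL => L.mp_mem φ ψ (h₁ L hL) (h₂ L hL)
      nec_mem := fun φ h L hL => L.nec_mem φ (h L hL)
      subst_mem := fun σ φ h L hL => L.subst_mem σ φ (h L hL) }

theorem isGLB_sInf (S : Set NormalLogic) : IsGLB S (sInf S) :=
  ⟨fun L hL _ hφ => hφ L hL, fun _ hM _ hφ _ hL => hM hL hφ⟩

instance : CompleteLattice NormalLogic := completeLatticeOfInf NormalLogic isGLB_sInf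

/-- `L₀ + Γ`: the least normal logic containing `L₀` and `Γ`. -/
def extendBy (L₀ : NormalLogic) (Γ : Set Formula) : NormalLogic :=
  sInf {L | L₀ ≤ L ∧ Γ ⊆ L.carrier}

/-- `K`: the least normal logic. -/
def K : NormalLogic := ⊥

/-- The pre-transitive logic `K4^{m+1}_1 = K + ◇^{m+1} p → ◇p`. -/
def preTrans (m : ℕ) : NormalLogic :=
  K.extendBy {((Formula.var 0).diaPow (m + 1)).imp (Formula.var 0).dia}

end NormalLogic

/-- `NExt L₀`: the lattice of normal extensions of `L₀`, ordered by inclusion. -/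
def NExt (L₀ : NormalLogic) : Type := {L : NormalLogic // L₀ ≤ L}

namespace NExt

variable {L₀ : NormalLogic}

/-- The underlying logic. -/
def logic (L : NExt L₀) : NormalLogic := L.1

instance : PartialOrder (NExt L₀) := inferInstanceAs (PartialOrder {L : NormalLogic // L₀ ≤ L})

instance : InfSet (NExt L₀) where
  sInf S := ⟨sInf (logic '' S), le_sInf (by rintro _ ⟨L, _, rfl⟩; exact L.2)⟩

theorem isGLB_sInf (S : Set (NExt L₀)) : IsGLB S (sInf S) :=
  ⟨fun L hL => (_root_.sInf_le ⟨L, hL, rfl⟩ : sInf (logic '' S) ≤ L.logic),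
    fun M hM => (_root_.le_sInf (by rintro _ ⟨L, hL, rfl⟩; exact hM hL) :
      M.logic ≤ sInf (logic '' S))⟩

instance : CompleteLattice (NExt L₀) := completeLatticeOfInf (NExt L₀) isGLB_sInf

end NExt

/-! ### Splittings -/

/-- `(x, y)` is a splitting pair: `x ≰ y`, and every `z` satisfies `x ≤ z` or `z ≤ y`. -/
def IsSplittingPair {X : Type u} [CompleteLattice X] (x y : X) : Prop :=
  ¬ x ≤ y ∧ ∀ z : X, x ≤ z ∨ z ≤ y

/-- `x` is a splitting: there is a `y` such that `(x, y)` is a splitting pair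
(the corresponding `y` is then said to split the lattice). -/
def IsSplitting {X : Type u} [CompleteLattice X] (x : X) : Prop :=
  ∃ y : X, IsSplittingPair x y

/-- `x` is a union-splitting: the join of a (possibly empty) set of splittings. -/
def IsUnionSplitting {X : Type u} [CompleteLattice X] (x : X) : Prop :=
  ∃ S : Set X, (∀ s ∈ S, IsSplitting s) ∧ x = sSup S

/-! ### Modal algebras -/

/-- A modal algebra: a Boolean algebra with a unary operation preserving `0` and binary joins. -/
class ModalAlgebra (A : Type u) extends BooleanAlgebra A where
  dia : A → A
  dia_bot : dia ⊥ = ⊥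
  dia_sup : ∀ a b : A, dia (a ⊔ b) = dia a ⊔ dia b

namespace ModalAlgebra

/-- The value of a formula in a modal algebra under a valuation of the variables. -/
def eval {A : Type u} [ModalAlgebra A] (V : ℕ → A) : Formula → A
  | .var n => V n
  | .fls => ⊥
  | .imp φ ψ => (eval V φ)ᶜ ⊔ eval V ψ
  | .dia φ => dia (eval V φ)

/-- `A ⊨ φ`. -/
def Validates (A : Type u) [ModalAlgebra A] (φ : Formula) : Prop :=
  ∀ V : ℕ → A, eval V φ = ⊤

/-- `A` is an `L`-algebra: it validates every formula of `L`. -/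
def IsAlgebraOf (A : Type u) [ModalAlgebra A] (L : NormalLogic) : Prop :=
  ∀ φ ∈ L.carrier, Validates A φ

/-- Congruences of a modal algebra. (Compatibility with the remaining Boolean operations follows.) -/
structure IsCongruence {A : Type u} [ModalAlgebra A] (θ : Setoid A) : Prop where
  sup : ∀ a a' b b' : A, θ a a' → θ b b' → θ (a ⊔ b) (a' ⊔ b')
  compl : ∀ a a' : A, θ a a' → θ aᶜ a'ᶜ
  dia : ∀ a a' : A, θ a a' → θ (ModalAlgebra.dia a) (ModalAlgebra.dia a')

/-- `A` is subdirectly irreducible: among its congruences other than equality there is a least one.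
In particular the one-element algebra is not subdirectly irreducible. -/
def IsSubdirectlyIrreducible (A : Type u) [ModalAlgebra A] : Prop :=
  ∃ θ : Setoid A, IsCongruence θ ∧ θ ≠ ⊥ ∧
    ∀ θ' : Setoid A, IsCongruence θ' → θ' ≠ ⊥ → θ ≤ θ'

end ModalAlgebra

/-! ### Stable canonical rules and formulas -/

/-- A finite modal algebra. -/
structure FinModalAlgebra : Type (u + 1) where
  carrier : Type u
  [str : ModalAlgebra carrier]
  [fin : Finite carrier]

namespace FinModalAlgebra

open ModalAlgebra

instance : CoeSort FinModalAlgebra.{u} (Type u) := ⟨carrier⟩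

instance (A : FinModalAlgebra.{u}) : ModalAlgebra A := A.str

instance (A : FinModalAlgebra.{u}) : Finite A := A.fin

/-- The propositional variables `p_a`, pairwise distinct for distinct `a ∈ A`. -/
noncomputable def p (A : FinModalAlgebra.{u}) (a : A) : Formula :=
  Formula.var (Finite.equivFin A a)

theorem p_injective (A : FinModalAlgebra.{u}) : Function.Injective A.p := by
  intro a b h
  have h' := Formula.var.inj h
  exact (Finite.equivFin A).injective (Fin.ext h')

/-- The premises `Γ` of the stable canonical rule `ρ(A, D)`. -/
def premises (A : FinModalAlgebra.{u}) (D : Set A) : Set Formula :=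
  {φ | ∃ a b : A, φ = (A.p (a ⊔ b)).iff ((A.p a).or (A.p b))} ∪
  {φ | ∃ a : A, φ = (A.p aᶜ).iff (A.p a).neg} ∪
  {φ | ∃ a : A, φ = (A.p a).dia.imp (A.p (dia a))} ∪
  {φ | ∃ a ∈ D, φ = (A.p (dia a)).imp (A.p a).dia}

/-- The conclusions `Δ` of the stable canonical rule `ρ(A, D)`. -/
def conclusions (A : FinModalAlgebra.{u}) : Set Formula :=
  {φ | ∃ a : A, a ≠ ⊤ ∧ φ = A.p a}

theorem premises_finite (A : FinModalAlgebra.{u}) (D : Set A) : (A.premises D).Finite := by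
  refine Set.Finite.union (Set.Finite.union (Set.Finite.union ?_ ?_) ?_) ?_
  · refine (Set.finite_range fun x : A × A =>
      (A.p (x.1 ⊔ x.2)).iff ((A.p x.1).or (A.p x.2))).subset ?_
    rintro _ ⟨a, b, rfl⟩
    exact ⟨(a, b), rfl⟩
  · refine (Set.finite_range fun a : A => (A.p aᶜ).iff (A.p a).neg).subset ?_
    rintro _ ⟨a, rfl⟩
    exact ⟨a, rfl⟩
  · refine (Set.finite_range fun a : A => (A.p a).dia.imp (A.p (dia a))).subset ?_
    rintro _ ⟨a, rfl⟩
    exact ⟨a, rfl⟩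
  · refine (Set.finite_range fun a : A => (A.p (dia a)).imp (A.p a).dia).subset ?_
    rintro _ ⟨a, _, rfl⟩
    exact ⟨a, rfl⟩

theorem conclusions_finite (A : FinModalAlgebra.{u}) : A.conclusions.Finite := by
  refine (Set.finite_range A.p).subset ?_
  rintro _ ⟨a, _, rfl⟩
  exact ⟨a, rfl⟩

/-- The stable canonical formula
`γ^m(A, D) = □^{≤m} ⋀ Γ → ⋁ {□^{≤m} δ : δ ∈ Δ}`. -/
noncomputable def stableCanonicalFormula (m : ℕ) (A : FinModalAlgebra.{u}) (D : Set A) : Formula :=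
  ((Formula.conj (A.premises_finite D).toFinset).boxLe m).imp
    (Formula.disj ((A.conclusions_finite.image (Formula.boxLe m)).toFinset))

/-- The Jankov formula `γ^m(A, A)`. -/
noncomputable def jankovFormula (m : ℕ) (A : FinModalAlgebra.{u}) : Formula :=
  A.stableCanonicalFormula m Set.univ

end FinModalAlgebra

/-! Let A be a finite s.i. algebra for K4^{m+1}_1. In such algebras the elements □^{≤m}a are open
and induce congruences. An algebra B refuting the Jankov formula of A therefore validates nothing
that A refutes: modulo an open element of B, a ↦ p_a is a homomorphism, and it sends no refuting
value to ⊤ (`validates_of_not_validates_jankovFormula`). By completeness, every logic contains the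
formula or lies below Log A. Since A itself refutes the formula, this gives a splitting pair.

Conversely, let (L, y) be a splitting pair and choose φ in L outside y. The finite model property
(`exists_finite_si_of_notMem_preTrans`) yields a finite A refuting φ. Then L ≰ Log A, so Log A ≤ y.
Above the logic of a finite algebra, finitely generated algebras are finite, so a finite s.i.
y-algebra B refutes φ (`exists_finite_si_of_logicOf_le`). The splitting property again gives Log B ≤
y, hence y = Log B. As y determines its left partner, L is axiomatized by the Jankov formula of B.
Union-splittings follow by taking joins.

The finite model property uses the least filtration through subformulas prefixed by up to m
diamonds, with its relation then closed under the frame condition. -/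

/-! ### Theories and maximal theories -/

/-- A propositional theory: a set of formulas containing all tautologies and closed under modus
ponens. -/
structure IsTheory (T : Set Formula) : Prop where
  tautology : ∀ φ : Formula, φ.IsTautology → φ ∈ T
  mp : ∀ φ ψ : Formula, φ.imp ψ ∈ T → φ ∈ T → ψ ∈ T

theorem IsTheory.mp_tautology {T : Set Formula} (hT : IsTheory T) {φ ψ : Formula}
    (h : (φ.imp ψ).IsTautology) (hφ : φ ∈ T) : ψ ∈ T :=
  hT.mp _ _ (hT.tautology _ h) hφ

theorem IsTheory.mp_tautology₂ {T : Set Formula} (hT : IsTheory T) {φ ψ χ : Formula}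
    (h : (φ.imp (ψ.imp χ)).IsTautology) (hφ : φ ∈ T) (hψ : ψ ∈ T) : χ ∈ T :=
  hT.mp _ _ (hT.mp_tautology h hφ) hψ

/-- The deduction theorem: the theory generated by `T` and `ψ`. -/
theorem IsTheory.adjoin {T : Set Formula} (hT : IsTheory T) (ψ : Formula) :
    IsTheory {χ | ψ.imp χ ∈ T} where
  tautology φ h := hT.tautology _ fun v h0 hi => by
    rw [hi]
    exact fun _ => h v h0 hi
  mp φ χ h₁ h₂ := hT.mp_tautology₂ (fun v h0 hi => by simp only [hi]; tauto) h₁ h₂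

/-- Lindenbaum's lemma with φ in the role of falsum: a theory maximal among those omitting φ
contains ψ → φ for each ψ it omits, so membership in it is a truth assignment. -/
theorem IsTheory.exists_valuation {T : Set Formula} (hT : IsTheory T) {φ : Formula} (hφ : φ ∉ T) :
    ∃ v : Formula → Prop, ¬ v .fls ∧ (∀ ψ χ, v (ψ.imp χ) ↔ (v ψ → v χ)) ∧ (∀ ψ ∈ T, v ψ) ∧ ¬ v φ := by
  obtain ⟨M, hTM, hM⟩ := zorn_subset_nonempty {M : Set Formula | IsTheory M ∧ φ ∉ M} (by
    rintro c hc hch ⟨N, hN⟩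
    refine ⟨⋃₀ c, ⟨⟨fun ψ h => ⟨N, hN, (hc hN).1.tautology ψ h⟩, ?_⟩, ?_⟩,
      fun s hs => Set.subset_sUnion_of_mem hs⟩
    · rintro ψ χ ⟨N₁, h₁, h₁'⟩ ⟨N₂, h₂, h₂'⟩
      rcases hch.total h₁ h₂ with h | h
      · exact ⟨N₂, h₂, (hc h₂).1.mp _ _ (h h₁') h₂'⟩
      · exact ⟨N₁, h₁, (hc h₁).1.mp _ _ h₁' (h h₂')⟩
    · rintro ⟨N₁, h₁, h₁'⟩
      exact (hc h₁).2 h₁') T ⟨hT, hφ⟩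
  have hMT : IsTheory M := hM.prop.1
  have key : ∀ ψ, ψ ∉ M → ψ.imp φ ∈ M := by
    intro ψ hψ
    by_contra h
    refine hψ (hM.le_of_ge (y := {χ | ψ.imp χ ∈ M}) ⟨hMT.adjoin ψ, h⟩ (fun χ hχ => ?_) ?_)
    · exact hMT.mp_tautology (fun v h0 hi => by simp only [hi]; tauto) hχ
    · exact hMT.tautology _ fun v h0 hi => by simp only [hi]; tauto
  refine ⟨(· ∈ M), ?_, ?_, fun ψ h => hTM h, hM.prop.2⟩
  · exact fun h => hM.prop.2 (hMT.mp_tautology (fun v h0 hi => by simp only [hi]; tauto) h)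
  · refine fun ψ χ => ⟨hMT.mp ψ χ, fun h => ?_⟩
    by_cases hψ : ψ ∈ M
    · exact hMT.mp_tautology (fun v h0 hi => by simp only [hi]; tauto) (h hψ)
    · by_contra h'
      -- ψ → φ and (ψ → χ) → φ together entail φ.
      exact hM.prop.2 (hMT.mp_tautology₂ (fun v h0 hi => by simp only [hi]; tauto)
        (key _ hψ) (key _ h'))

/-! ### Kripke models and the canonical model -/

/-- A Kripke model, presented by its satisfaction relation. -/
structure KripkeModel (X : Type u) where
  rel : X → X → Prop
  sat : X → Formula → Prop
  not_sat_fls : ∀ x, ¬ sat x .fls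
  sat_imp : ∀ x φ ψ, sat x (φ.imp ψ) ↔ (sat x φ → sat x ψ)
  sat_dia : ∀ x φ, sat x φ.dia ↔ ∃ y, rel x y ∧ sat y φ

namespace NormalLogic

theorem isTheory (L : NormalLogic) : IsTheory L.carrier := ⟨L.tautology_mem, L.mp_mem⟩

/-- A point of the canonical model: a maximal consistent set of formulas, given by its
characteristic function. -/
structure World (L : NormalLogic) where
  sat : Formula → Prop
  not_sat_fls : ¬ sat .fls
  sat_imp : ∀ φ ψ, sat (φ.imp ψ) ↔ (sat φ → sat ψ)
  sat_of_mem : ∀ φ ∈ L.carrier, sat φ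

variable {L : NormalLogic}

theorem exists_world {φ : Formula} (h : φ ∉ L.carrier) : ∃ x : L.World, ¬ x.sat φ := by
  obtain ⟨v, h0, hi, hL, hv⟩ := L.isTheory.exists_valuation h
  exact ⟨⟨v, h0, hi, hL⟩, hv⟩

namespace World

theorem sat_neg (x : L.World) (φ : Formula) : x.sat φ.neg ↔ ¬ x.sat φ := by
  simp [Formula.neg, x.sat_imp, x.not_sat_fls]

theorem sat_and (x : L.World) (φ ψ : Formula) : x.sat (φ.and ψ) ↔ x.sat φ ∧ x.sat ψ := by
  simp [Formula.and, x.sat_imp, x.sat_neg]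

theorem sat_iff (x : L.World) (φ ψ : Formula) : x.sat (φ.iff ψ) ↔ (x.sat φ ↔ x.sat ψ) := by
  simp only [Formula.iff, x.sat_and, x.sat_imp]
  tauto

theorem sat_box_mp (x : L.World) {φ ψ : Formula} (h : x.sat (φ.imp ψ).box) (hφ : x.sat φ.box) :
    x.sat ψ.box := by
  have := x.sat_of_mem _ (L.subst_mem (fun n => if n = 0 then φ else ψ) _ L.axiomK_mem)
  simp only [Formula.subst, Formula.box, Formula.neg, if_true, one_ne_zero, if_false] at this h hφ
  exact (x.sat_imp _ _).1 ((x.sat_imp _ _).1 this h) hφ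

/-- Since □ abbreviates ¬◇¬, this is all that the duality axiom says. -/
theorem sat_dia_iff_neg_neg (x : L.World) (φ : Formula) :
    x.sat φ.dia ↔ x.sat φ.neg.neg.dia := by
  have := x.sat_of_mem _ (L.subst_mem (fun _ => φ) _ L.dual_mem)
  have h' : ((Formula.var 0).dia.iff (Formula.var 0).neg.box.neg).subst (fun _ => φ) =
    φ.dia.iff φ.neg.box.neg := rfl
  rw [h', sat_iff, sat_neg, Formula.box, sat_neg, not_not] at this
  exact this

theorem sat_box_neg (x : L.World) (φ : Formula) : x.sat φ.neg.box ↔ ¬ x.sat φ.dia := by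
  rw [Formula.box, sat_neg, ← sat_dia_iff_neg_neg]

/-- The formulas χ with □(ψ → χ) true at x form a theory containing L, ψ, and ¬χ whenever ◇χ fails
at x. It is consistent because ◇ψ holds at x. -/
theorem exists_of_sat_dia (x : L.World) {ψ : Formula} (h : x.sat ψ.dia) :
    ∃ y : L.World, (∀ χ, y.sat χ → x.sat χ.dia) ∧ y.sat ψ := by
  have hT : IsTheory {χ | x.sat (ψ.imp χ).box} := by
    refine ⟨fun φ hφ => x.sat_of_mem _ (L.nec_mem _ (L.tautology_mem _ fun v h0 hi => ?_)),
      fun φ χ h₁ h₂ => ?_⟩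
    · rw [hi]
      exact fun _ => hφ v h0 hi
    · refine x.sat_box_mp (x.sat_box_mp (x.sat_of_mem _ (L.nec_mem _ (L.tautology_mem _ ?_))) h₁) h₂
      intro v h0 hi
      simp only [hi]
      tauto
  obtain ⟨v, h0, hi, hv, -⟩ := hT.exists_valuation (φ := .fls)
    (fun h' => (x.sat_box_neg ψ).1 h' h)
  refine ⟨⟨v, h0, hi, fun φ hφ => hv _ (x.sat_of_mem _ (L.nec_mem _ ?_))⟩, fun χ hχ => ?_,
    hv _ (x.sat_of_mem _ (L.nec_mem _ (L.tautology_mem _ fun v h0 hi => ?_)))⟩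
  · exact L.isTheory.mp_tautology (fun v h0 hi => by simp only [hi]; tauto) hφ
  · by_contra hx
    have : v χ.neg := by
      refine hv _ (x.sat_box_mp (x.sat_of_mem _ (L.nec_mem _ (L.tautology_mem _ ?_)))
        ((x.sat_box_neg χ).2 hx))
      intro v h0 hi
      simp only [hi]
      tauto
    exact h0 ((hi _ _).1 this hχ)
  · rw [hi]
    exact id

end World

/-- The canonical model of a normal modal logic. -/
def canonicalModel (L : NormalLogic) : KripkeModel L.World where
  rel x y := ∀ φ, y.sat φ → x.sat φ.dia
  sat x := x.sat
  not_sat_fls x := x.not_sat_fls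
  sat_imp x := x.sat_imp
  sat_dia x _ := ⟨x.exists_of_sat_dia, fun ⟨_, hy, hφ⟩ => hy _ hφ⟩

end NormalLogic

/-! ### Semantics of formulas in modal algebras -/

theorem Formula.exists_subst_eq_self (φ : Formula) :
    ∃ N : ℕ, ∀ σ : ℕ → Formula, (∀ i < N, σ i = .var i) → φ.subst σ = φ := by
  induction φ with
  | var n => exact ⟨n + 1, fun σ h => h n n.lt_succ_self⟩
  | fls => exact ⟨0, fun _ _ => rfl⟩
  | imp φ ψ hφ hψ =>
    obtain ⟨N, hN⟩ := hφ
    obtain ⟨N', hN'⟩ := hψ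
    refine ⟨max N N', fun σ h => ?_⟩
    rw [Formula.subst, hN σ fun i hi => h i (lt_max_of_lt_left hi),
      hN' σ fun i hi => h i (lt_max_of_lt_right hi)]
  | dia φ hφ =>
    obtain ⟨N, hN⟩ := hφ
    exact ⟨N, fun σ h => by rw [Formula.subst, hN σ h]⟩

theorem Formula.subst_var (φ : Formula) : φ.subst Formula.var = φ := by
  induction φ with
  | var n => rfl
  | fls => rfl
  | imp φ ψ hφ hψ => rw [Formula.subst, hφ, hψ]
  | dia φ hφ => rw [Formula.subst, hφ]

namespace ModalAlgebra

variable {A : Type u} [ModalAlgebra A]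

theorem dia_mono {a b : A} (h : a ≤ b) : dia a ≤ dia b := by
  rw [← sup_eq_right.2 h, dia_sup]
  exact le_sup_left

/-- The dual operator `□a = ¬◇¬a`. -/
def bx (a : A) : A := (dia aᶜ)ᶜ

theorem bx_top : bx (⊤ : A) = ⊤ := by simp [bx, dia_bot]

theorem bx_inf (a b : A) : bx (a ⊓ b) = bx a ⊓ bx b := by
  simp [bx, compl_inf, dia_sup]

theorem bx_mono {a b : A} (h : a ≤ b) : bx a ≤ bx b :=
  compl_le_compl (dia_mono (compl_le_compl h))

/-- `□^{≤k} a`. -/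
def bxLe : ℕ → A → A
  | 0, a => a
  | k + 1, a => bxLe k a ⊓ bx^[k + 1] a

theorem le_bxLe_iff {k : ℕ} {a c : A} : c ≤ bxLe k a ↔ ∀ i ≤ k, c ≤ bx^[i] a := by
  induction k with
  | zero => simp [bxLe]
  | succ k ih =>
    rw [bxLe, le_inf_iff, ih]
    constructor
    · rintro ⟨h, h'⟩ i hi
      rcases Nat.le_succ_iff.1 hi with hi | rfl
      exacts [h i hi, h']
    · exact fun h => ⟨fun i hi => h i (hi.trans k.le_succ), h _ le_rfl⟩

theorem le_bx_bxLe_iff {k : ℕ} {a c : A} : c ≤ bx (bxLe k a) ↔ ∀ i ≤ k, c ≤ bx^[i + 1] a := by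
  induction k with
  | zero => simp [bxLe]
  | succ k ih =>
    rw [bxLe, bx_inf, le_inf_iff, ih, ← Function.iterate_succ_apply' bx]
    constructor
    · rintro ⟨h, h'⟩ i hi
      rcases Nat.le_succ_iff.1 hi with hi | rfl
      exacts [h i hi, h']
    · exact fun h => ⟨fun i hi => h i (hi.trans k.le_succ), h _ le_rfl⟩

theorem bxLe_le (k : ℕ) (a : A) : bxLe k a ≤ a := le_bxLe_iff.1 le_rfl 0 (Nat.zero_le _)

theorem bxLe_mono (k : ℕ) {a b : A} (h : a ≤ b) : bxLe k a ≤ bxLe k b :=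
  le_bxLe_iff.2 fun i hi => (le_bxLe_iff.1 le_rfl i hi).trans
    ((show Monotone (bx : A → A) from fun _ _ => bx_mono).iterate i h)

theorem le_bxLe_of_le_bx {g : A} (h : g ≤ bx g) (k : ℕ) : g ≤ bxLe k g := by
  refine le_bxLe_iff.2 fun i _ => ?_
  induction i with
  | zero => exact le_rfl
  | succ i ih =>
    rw [Function.iterate_succ_apply']
    exact h.trans (bx_mono (ih (by omega)))

theorem bxLe_top (k : ℕ) : bxLe k (⊤ : A) = ⊤ :=
  top_le_iff.1 (le_bxLe_of_le_bx bx_top.ge k)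

variable (V : ℕ → A)

theorem eval_neg (φ : Formula) : eval V φ.neg = (eval V φ)ᶜ := by
  simp [Formula.neg, eval]

theorem eval_or (φ ψ : Formula) : eval V (φ.or ψ) = eval V φ ⊔ eval V ψ := by
  simp [Formula.or, eval, eval_neg]

theorem eval_and (φ ψ : Formula) : eval V (φ.and ψ) = eval V φ ⊓ eval V ψ := by
  simp [Formula.and, eval, eval_neg]

theorem eval_box (φ : Formula) : eval V φ.box = bx (eval V φ) := by
  simp [Formula.box, eval, eval_neg, bx]

theorem eval_boxPow (n : ℕ) (φ : Formula) : eval V (φ.boxPow n) = bx^[n] (eval V φ) := by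
  induction n with
  | zero => rfl
  | succ n ih => rw [Formula.boxPow, eval_box, ih, Function.iterate_succ_apply']

theorem eval_diaPow (n : ℕ) (φ : Formula) : eval V (φ.diaPow n) = dia^[n] (eval V φ) := by
  induction n with
  | zero => rfl
  | succ n ih => rw [Formula.diaPow, eval, ih, Function.iterate_succ_apply']

theorem eval_boxLe (n : ℕ) (φ : Formula) : eval V (φ.boxLe n) = bxLe n (eval V φ) := by
  induction n with
  | zero => rfl
  | succ n ih => rw [Formula.boxLe, eval_and, ih, eval_boxPow, bxLe]

theorem eval_imp (φ ψ : Formula) : eval V (φ.imp ψ) = eval V φ ⇨ eval V ψ := by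
  rw [eval, himp_eq, sup_comm]

theorem eval_imp_eq_top_iff (φ ψ : Formula) :
    eval V (φ.imp ψ) = ⊤ ↔ eval V φ ≤ eval V ψ := by
  rw [eval_imp, himp_eq_top_iff]

/-- Turns biconditionals true on g into the congruence modulo g used by `openSetoid`. -/
theorem le_eval_iff_iff (φ ψ : Formula) (g : A) :
    g ≤ eval V (φ.iff ψ) ↔ eval V φ ⊓ g = eval V ψ ⊓ g := by
  simp only [Formula.iff, eval_and, eval_imp, le_inf_iff, le_himp_iff]
  constructor
  · rintro ⟨h₁, h₂⟩
    refine le_antisymm (le_inf ?_ inf_le_right) (le_inf ?_ inf_le_right)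
    · rwa [inf_comm]
    · rwa [inf_comm]
  · intro h
    rw [inf_comm g, inf_comm g, h]
    exact ⟨inf_le_left, h.symm ▸ inf_le_left⟩

theorem le_eval_conj_iff {S : Finset Formula} {g : A} :
    g ≤ eval V (Formula.conj S) ↔ ∀ φ ∈ S, g ≤ eval V φ := by
  have : ∀ l : List Formula, g ≤ eval V (Formula.listConj l) ↔ ∀ φ ∈ l, g ≤ eval V φ := by
    intro l
    induction l with
    | nil => simp [Formula.listConj, Formula.tru, eval_neg, eval]
    | cons φ l ih => simp [Formula.listConj, eval_and, ih]
  simp [Formula.conj, this]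

theorem eval_disj_le_iff {S : Finset Formula} {g : A} :
    eval V (Formula.disj S) ≤ g ↔ ∀ φ ∈ S, eval V φ ≤ g := by
  have : ∀ l : List Formula, eval V (Formula.listDisj l) ≤ g ↔ ∀ φ ∈ l, eval V φ ≤ g := by
    intro l
    induction l with
    | nil => simp [Formula.listDisj, eval]
    | cons φ l ih => simp [Formula.listDisj, eval_or, ih]
  simp [Formula.disj, this]

theorem eval_subst (σ : ℕ → Formula) (φ : Formula) :
    eval V (φ.subst σ) = eval (fun n => eval V (σ n)) φ := by
  induction φ with
  | var n => rfl
  | fls => rfl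
  | imp φ ψ hφ hψ => rw [Formula.subst, eval, eval, hφ, hψ]
  | dia φ hφ => rw [Formula.subst, eval, eval, hφ]

/-- In a finite algebra, an atom below the complement of a value ≠ ⊤ gives a refuting truth
assignment. -/
theorem eval_eq_top_of_isTautology [Finite A] {φ : Formula} (h : φ.IsTautology) :
    eval V φ = ⊤ := by
  by_contra hne
  obtain ⟨a, ha, hle⟩ := (eq_bot_or_exists_atom_le (eval V φ)ᶜ).resolve_left
    (by rwa [compl_eq_bot])
  refine ha.1 (le_bot_iff.1 ?_)
  have := h (fun ψ => a ≤ eval V ψ) (fun h => ha.1 (le_bot_iff.1 h)) (fun ψ χ => ?_)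
  · rw [← inf_compl_eq_bot (a := eval V φ)]
    exact le_inf this hle
  · rw [eval_imp, le_himp_iff]
    constructor
    · exact fun h hψ => (le_inf le_rfl hψ).trans h
    · intro h
      rcases ha.le_iff.1 (inf_le_left : a ⊓ eval V ψ ≤ a) with h' | h'
      · exact h' ▸ bot_le
      · exact inf_le_left.trans (h (inf_eq_left.1 h'))

variable (A) in
/-- The logic of a finite modal algebra. -/
def logicOf [Finite A] : NormalLogic where
  carrier := {φ | Validates A φ}
  tautology_mem φ h V := eval_eq_top_of_isTautology V h
  axiomK_mem V := by
    rw [eval_imp_eq_top_iff, eval_imp, le_himp_iff, eval_box, eval_box, eval_box, ← bx_inf]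
    refine bx_mono ?_
    rw [eval_imp]
    exact himp_inf_le
  dual_mem V := by
    rw [← top_le_iff, le_eval_iff_iff, eval_neg, eval_box, eval_neg]
    simp [bx, eval]
  mp_mem φ ψ h₁ h₂ V := by
    have := (eval_imp_eq_top_iff V φ ψ).1 (h₁ V)
    rwa [h₂ V, top_le_iff] at this
  nec_mem φ h V := by rw [eval_box, h V, bx_top]
  subst_mem σ φ h V := by rw [eval_subst, h]

/-- Every open element induces a congruence. -/
def openSetoid (g : A) : Setoid A where
  r a b := a ⊓ g = b ⊓ g
  iseqv := ⟨fun _ => rfl, fun h => h.symm, fun h h' => h.trans h'⟩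

theorem openSetoid_apply {g a b : A} : openSetoid g a b ↔ a ⊓ g = b ⊓ g := Iff.rfl

theorem isCongruence_openSetoid {g : A} (hg : g ≤ bx g) : IsCongruence (openSetoid g) where
  sup a a' b b' h h' := by
    rw [openSetoid_apply] at *
    rw [inf_sup_right, h, h', inf_sup_right]
  compl a a' h := by
    have : ∀ x : A, xᶜ ⊓ g = (x ⊓ g)ᶜ ⊓ g := fun x => by
      rw [compl_inf, inf_sup_right, compl_inf_self, sup_bot_eq]
    rw [openSetoid_apply] at *
    rw [this a, h, this a']
  dia a a' h := by
    -- The part of x outside g contributes at most ◇¬g, which is disjoint from □g ≥ g.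
    have key : ∀ x : A, dia x ⊓ g = dia (x ⊓ g) ⊓ g := fun x => by
      refine le_antisymm (le_inf ?_ inf_le_right) (inf_le_inf_right _ (dia_mono inf_le_left))
      have h₁ : dia x = dia (x ⊓ g) ⊔ dia (x ⊓ gᶜ) := by
        rw [← dia_sup, ← inf_sup_left, sup_compl_eq_top, inf_top_eq]
      rw [h₁, inf_sup_right]
      refine sup_le inf_le_left (le_trans ?_ bot_le)
      calc dia (x ⊓ gᶜ) ⊓ g ≤ dia gᶜ ⊓ bx g := inf_le_inf (dia_mono inf_le_right) hg
        _ = ⊥ := by rw [bx, inf_compl_eq_bot]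
    rw [openSetoid_apply] at *
    rw [key a, h, key a']

theorem IsCongruence.inf {θ : Setoid A} (h : IsCongruence θ) {a a' b b' : A} (ha : θ a a')
    (hb : θ b b') : θ (a ⊓ b) (a' ⊓ b') := by
  have := h.compl _ _ (h.sup _ _ _ _ (h.compl _ _ ha) (h.compl _ _ hb))
  simpa using this

end ModalAlgebra

/-! ### Pre-transitivity, open elements and subdirect irreducibility -/

namespace NormalLogic

theorem extendBy_le_iff {L₀ L : NormalLogic} {Γ : Set Formula} :
    L₀.extendBy Γ ≤ L ↔ L₀ ≤ L ∧ Γ ⊆ L.carrier := by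
  refine ⟨fun h => ⟨le_trans (le_sInf fun M hM => hM.1) h, fun φ hφ => h ?_⟩, fun h => sInf_le h⟩
  exact fun M hM => hM.2 hφ

theorem preTrans_le_iff {m : ℕ} {L : NormalLogic} : preTrans m ≤ L ↔
    (((Formula.var 0).diaPow (m + 1)).imp (Formula.var 0).dia) ∈ L.carrier := by
  rw [preTrans, extendBy_le_iff, Set.singleton_subset_iff]
  exact and_iff_right bot_le

end NormalLogic

namespace Formula

theorem subst_diaPow (σ : ℕ → Formula) (n : ℕ) (φ : Formula) :
    (φ.diaPow n).subst σ = (φ.subst σ).diaPow n := by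
  induction n with
  | zero => rfl
  | succ n ih => rw [diaPow, subst, ih, diaPow]

end Formula

namespace ModalAlgebra

open NormalLogic

variable {A : Type u} [ModalAlgebra A]

theorem iterate_bx (n : ℕ) (a : A) : bx^[n] a = (dia^[n] aᶜ)ᶜ := by
  induction n with
  | zero => simp
  | succ n ih => rw [Function.iterate_succ_apply', ih, Function.iterate_succ_apply', bx, compl_compl]

theorem validates_preTrans_axiom_iff {m : ℕ} :
    Validates A (((Formula.var 0).diaPow (m + 1)).imp (Formula.var 0).dia) ↔
      ∀ a : A, dia^[m + 1] a ≤ dia a := by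
  have key : ∀ V : ℕ → A, eval V (((Formula.var 0).diaPow (m + 1)).imp (Formula.var 0).dia) = ⊤ ↔
      dia^[m + 1] (V 0) ≤ dia (V 0) := fun V => by
    rw [eval_imp_eq_top_iff, eval_diaPow]
    rfl
  simp only [Validates, key]
  exact ⟨fun h a => h fun _ => a, fun h V => h _⟩

theorem iterate_dia_le {m : ℕ} (hA : IsAlgebraOf A (preTrans m)) (a : A) :
    dia^[m + 1] a ≤ dia a :=
  validates_preTrans_axiom_iff.1 (hA _ (preTrans_le_iff.1 le_rfl)) a

/-- In a `K4^{m+1}_1`-algebra the elements `□^{≤m} a` are open. -/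
theorem bxLe_le_bx {m : ℕ} (hm : 1 ≤ m) (hA : IsAlgebraOf A (preTrans m)) (a : A) :
    bxLe m a ≤ bx (bxLe m a) := by
  refine le_bx_bxLe_iff.2 fun i hi => ?_
  rcases hi.lt_or_eq with hi | rfl
  · exact le_bxLe_iff.1 le_rfl _ hi
  -- Only i = m needs the axiom, in the dual form □a ≤ □^{m+1}a; □a is among the conjuncts because m
  -- ≥ 1.
  · refine (le_bxLe_iff.1 le_rfl 1 hm).trans ?_
    rw [iterate_bx, iterate_bx]
    exact compl_le_compl (iterate_dia_le hA _)

theorem bxLe_le_bxLe_bxLe {m : ℕ} (hm : 1 ≤ m) (hA : IsAlgebraOf A (preTrans m)) (a : A) :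
    bxLe m a ≤ bxLe m (bxLe m a) :=
  le_bxLe_of_le_bx (bxLe_le_bx hm hA a) m

/-- If the least nontrivial congruence identifies x ≠ y, then c = (x ↔ y) works: each □^{≤m}a with a
≠ ⊤ induces a nontrivial congruence, which must identify x and y. -/
theorem IsSubdirectlyIrreducible.exists_opremum {m : ℕ} (hm : 1 ≤ m)
    (hA : IsAlgebraOf A (preTrans m)) (h : IsSubdirectlyIrreducible A) :
    ∃ c : A, c ≠ ⊤ ∧ ∀ a : A, a ≠ ⊤ → bxLe m a ≤ c := by
  obtain ⟨θ, hθ, hne, hle⟩ := h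
  have : ∃ x y, θ x y ∧ x ≠ y := by
    by_contra! h
    exact hne (Setoid.ext fun x y => ⟨h x y, fun e => by
      have : x = y := e
      exact this ▸ θ.refl x⟩)
  obtain ⟨x, y, hxy, hxy'⟩ := this
  refine ⟨bihimp x y, mt bihimp_eq_top.1 hxy', fun a ha => ?_⟩
  have hg := bxLe_le_bx hm hA a
  have h₁ : openSetoid (bxLe m a) x y := by
    refine hle _ (isCongruence_openSetoid hg) (fun e => ha ?_) hxy
    have h₂ : openSetoid (bxLe m a) (bxLe m a) ⊤ := by simp [openSetoid_apply]
    rw [e] at h₂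
    have h₃ : bxLe m a = ⊤ := h₂
    exact top_le_iff.1 (h₃ ▸ bxLe_le m a)
  rw [openSetoid_apply] at h₁
  rw [bihimp, le_inf_iff, le_himp_iff, le_himp_iff, inf_comm _ x, inf_comm _ y]
  exact ⟨h₁ ▸ inf_le_left, h₁.symm ▸ inf_le_left⟩

/-- The least nontrivial congruence is the one induced by □^{≤m}c. Any other that identifies x ≠ y
sends □^{≤m}(x ↔ y), hence the larger element □^{≤m}c, to ⊤. -/
theorem isSubdirectlyIrreducible_of_opremum {m : ℕ} (hm : 1 ≤ m)
    (hA : IsAlgebraOf A (preTrans m)) {c : A} (hc : c ≠ ⊤) (h : ∀ a : A, a ≠ ⊤ → bxLe m a ≤ c) :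
    IsSubdirectlyIrreducible A := by
  have hg := bxLe_le_bx hm hA c
  refine ⟨openSetoid (bxLe m c), isCongruence_openSetoid hg, fun e => hc ?_, fun θ hθ hne => ?_⟩
  · have h₂ : openSetoid (bxLe m c) (bxLe m c) ⊤ := by simp [openSetoid_apply]
    rw [e] at h₂
    have h₃ : bxLe m c = ⊤ := h₂
    exact top_le_iff.1 (h₃ ▸ bxLe_le m c)
  · have : ∃ x y, θ x y ∧ x ≠ y := by
      by_contra! h
      exact hne (Setoid.ext fun x y => ⟨h x y, fun e => by
        have : x = y := e
        exact this ▸ θ.refl x⟩)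
    obtain ⟨x, y, hxy, hxy'⟩ := this
    have h₁ : θ (bihimp x y) ⊤ := by
      have h₁ := hθ.inf (hθ.sup _ _ _ _ (θ.refl x) (hθ.compl _ _ (θ.symm hxy)))
        (hθ.sup _ _ _ _ (θ.refl y) (hθ.compl _ _ hxy))
      rw [sup_compl_eq_top, sup_compl_eq_top, top_inf_eq] at h₁
      rwa [bihimp_eq]
    have h₂ : ∀ k, θ (bx^[k] (bihimp x y)) ⊤ := by
      intro k
      induction k with
      | zero => exact h₁
      | succ k ih =>
        rw [Function.iterate_succ_apply']
        have := hθ.compl _ _ (hθ.dia _ _ (hθ.compl _ _ ih))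
        rwa [compl_top, dia_bot, compl_bot] at this
    have h₃ : ∀ k, θ (bxLe k (bihimp x y)) ⊤ := by
      intro k
      induction k with
      | zero => exact h₁
      | succ k ih =>
        have := hθ.inf ih (h₂ (k + 1))
        rwa [top_inf_eq] at this
    have h₄ : θ (bxLe m c) ⊤ := by
      have := hθ.sup _ _ _ _ (θ.refl (bxLe m c)) (h₃ m)
      rwa [sup_top_eq, sup_eq_left.2] at this
      exact (bxLe_le_bxLe_bxLe hm hA _).trans (bxLe_mono m (h _ (mt bihimp_eq_top.1 hxy')))
    intro a b hab
    have hab' : a ⊓ bxLe m c = b ⊓ bxLe m c := hab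
    have ha : ∀ a, θ (a ⊓ bxLe m c) a := fun a => by
      simpa using hθ.inf (θ.refl a) h₄
    have ha' := ha a
    rw [hab'] at ha'
    exact θ.trans (θ.symm ha') (ha b)

end ModalAlgebra

/-! ### Jankov formulas -/

namespace FinModalAlgebra

open ModalAlgebra NormalLogic

theorem exists_eval_p {B : Type*} [ModalAlgebra B] (A : FinModalAlgebra.{u}) (g : A → B) :
    ∃ V : ℕ → B, ∀ a, eval V (A.p a) = g a := by
  -- Larger indices code no element of A, so the value ⊥ is immaterial.
  refine ⟨fun n => if h : n < Nat.card A then g ((Finite.equivFin A).symm ⟨n, h⟩) else ⊥,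
    fun a => ?_⟩
  simp [p, eval]

theorem le_eval_conj_premises_iff {B : Type*} [ModalAlgebra B] (A : FinModalAlgebra.{u})
    (V : ℕ → B) (g : B) :
    g ≤ eval V (Formula.conj (A.premises_finite Set.univ).toFinset) ↔
      (∀ a b, eval V (A.p (a ⊔ b)) ⊓ g = (eval V (A.p a) ⊔ eval V (A.p b)) ⊓ g) ∧
      (∀ a, eval V (A.p aᶜ) ⊓ g = (eval V (A.p a))ᶜ ⊓ g) ∧
      ∀ a, eval V (A.p (dia a)) ⊓ g = dia (eval V (A.p a)) ⊓ g := by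
  rw [le_eval_conj_iff]
  simp only [Set.Finite.mem_toFinset, premises]
  constructor
  · intro h
    refine ⟨fun a b => ?_, fun a => ?_, fun a => ?_⟩
    · have := h _ (.inl (.inl (.inl ⟨a, b, rfl⟩)))
      rwa [le_eval_iff_iff, eval_or] at this
    · have := h _ (.inl (.inl (.inr ⟨a, rfl⟩)))
      rwa [le_eval_iff_iff, eval_neg] at this
    · have h₁ := h _ (.inl (.inr ⟨a, rfl⟩))
      have h₂ := h _ (.inr ⟨a, trivial, rfl⟩)
      have := (le_eval_iff_iff V (A.p (dia a)) (A.p a).dia g).1 (by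
        rw [Formula.iff, eval_and]
        exact le_inf h₂ h₁)
      rwa [eval] at this
  · rintro ⟨h₁, h₂, h₃⟩ _ (((⟨a, b, rfl⟩ | ⟨a, rfl⟩) | ⟨a, rfl⟩) | ⟨a, -, rfl⟩)
    · rw [le_eval_iff_iff, eval_or, h₁]
    · rw [le_eval_iff_iff, eval_neg, h₂]
    · rw [eval_imp, le_himp_iff, inf_comm, eval, ← h₃]
      exact inf_le_left
    · rw [eval_imp, le_himp_iff, inf_comm, h₃]
      exact inf_le_left

theorem eval_jankovFormula_eq_top_iff {B : Type*} [ModalAlgebra B] (A : FinModalAlgebra.{u})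
    (m : ℕ) (V : ℕ → B) :
    eval V (A.jankovFormula m) = ⊤ ↔
      bxLe m (eval V (Formula.conj (A.premises_finite Set.univ).toFinset)) ≤
        eval V (Formula.disj ((A.conclusions_finite.image (Formula.boxLe m)).toFinset)) := by
  rw [jankovFormula, stableCanonicalFormula, eval_imp_eq_top_iff, eval_boxLe]

/-- Under p_a ↦ a the premises evaluate to ⊤, while every disjunct of the conclusion stays below the
c of `exists_opremum`. -/
theorem not_validates_jankovFormula (A : FinModalAlgebra.{u}) {m : ℕ} (hm : 1 ≤ m)
    (hA : IsAlgebraOf A (preTrans m)) (h : IsSubdirectlyIrreducible A) :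
    ¬ Validates A (A.jankovFormula m) := by
  obtain ⟨c, hc, hc'⟩ := h.exists_opremum hm hA
  obtain ⟨V, hV⟩ := A.exists_eval_p (B := A) id
  intro hval
  have h₁ := (A.eval_jankovFormula_eq_top_iff m V).1 (hval V)
  have h₂ : ⊤ ≤ eval V (Formula.conj (A.premises_finite Set.univ).toFinset) := by
    rw [le_eval_conj_premises_iff]
    simp [hV]
  rw [top_le_iff.1 h₂, bxLe_top] at h₁
  refine hc (top_le_iff.1 (h₁.trans (eval_disj_le_iff V |>.2 ?_)))
  simp only [Set.Finite.mem_toFinset]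
  rintro _ ⟨_, ⟨a, ha, rfl⟩, rfl⟩
  rw [eval_boxLe, hV]
  exact hc' a ha

/-- Every valuation of a `K4^{m+1}_1`-algebra `B` refuting the Jankov formula of `A` yields an
embedding of `A` into a quotient of `B`; hence `A` validates the formulas valid in `B`. -/
theorem validates_of_not_validates_jankovFormula (A : FinModalAlgebra.{u}) {m : ℕ} (hm : 1 ≤ m)
    {B : Type*} [ModalAlgebra B] (hB : IsAlgebraOf B (preTrans m))
    (h : ¬ Validates B (A.jankovFormula m)) {φ : Formula} (hφ : Validates B φ) :
    Validates A φ := by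
  intro W
  by_contra hne
  refine h fun V => ?_
  rw [eval_jankovFormula_eq_top_iff]
  set g := bxLe m (eval V (Formula.conj (A.premises_finite Set.univ).toFinset)) with hg
  obtain ⟨hsup, hcompl, hdia⟩ := (A.le_eval_conj_premises_iff V g).1 (bxLe_le m _)
  have hopen : g ≤ bx g := bxLe_le_bx hm hB _
  have hθ := isCongruence_openSetoid hopen
  -- No premise mentions ⊥; it is recovered as ¬(⊥ ∨ ¬⊥).
  have hbot : openSetoid g (eval V (A.p ⊥)) ⊥ := by
    have h₁ : openSetoid g (eval V (A.p (⊥ ⊔ (⊥ : A)ᶜ)ᶜ)) ((eval V (A.p ⊥)) ⊔ (eval V (A.p ⊥))ᶜ)ᶜ :=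
      (openSetoid g).trans (hcompl _) (hθ.compl _ _ ((openSetoid g).trans (hsup _ _)
        (hθ.sup _ _ _ _ ((openSetoid g).refl _) (hcompl _))))
    rwa [sup_compl_eq_top, sup_compl_eq_top, compl_top, compl_top] at h₁
  have key : ∀ ψ : Formula, openSetoid g (eval V (A.p (eval W ψ)))
      (eval V (ψ.subst fun n => A.p (W n))) := by
    intro ψ
    induction ψ with
    | var n => exact (openSetoid g).refl _
    | fls => exact hbot
    | imp ψ χ hψ hχ =>
      exact (openSetoid g).trans (hsup _ _) (hθ.sup _ _ _ _
        ((openSetoid g).trans (hcompl _) (hθ.compl _ _ hψ)) hχ)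
    | dia ψ hψ => exact (openSetoid g).trans (hdia _) (hθ.dia _ _ hψ)
  -- Validity of φ in B puts g below the value of p_a for a = `eval W φ` ≠ ⊤, which indexes a
  -- disjunct of the conclusion. Injectivity modulo g is not needed.
  have h₁ := key φ
  rw [openSetoid_apply, eval_subst, hφ, top_inf_eq, inf_eq_right] at h₁
  calc g ≤ bxLe m g := le_bxLe_of_le_bx hopen m
    _ ≤ bxLe m (eval V (A.p (eval W φ))) := bxLe_mono m h₁
    _ ≤ _ := by
      rw [← eval_boxLe]
      refine (eval_disj_le_iff V).1 le_rfl _ ?_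
      rw [Set.Finite.mem_toFinset]
      exact ⟨_, ⟨_, hne, rfl⟩, rfl⟩

end FinModalAlgebra

/-! ### Definable algebras of Kripke models -/

namespace KripkeModel

open ModalAlgebra NormalLogic

variable {X : Type u} (M : KripkeModel X) (τ : ℕ → Formula)

/-- The Boolean algebra of the subsets of a model defined by substitution instances under `τ`. -/
def definable : BooleanSubalgebra (Set X) where
  carrier := {s | ∃ φ : Formula, s = {x | M.sat x (φ.subst τ)}}
  supClosed' := by
    rintro _ ⟨φ, rfl⟩ _ ⟨ψ, rfl⟩
    refine ⟨φ.or ψ, ?_⟩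
    ext x
    simp only [Formula.or, Formula.neg, Formula.subst, M.sat_imp, Set.sup_eq_union, Set.mem_union,
      Set.mem_ofPred_eq, M.not_sat_fls]
    tauto
  infClosed' := by
    rintro _ ⟨φ, rfl⟩ _ ⟨ψ, rfl⟩
    refine ⟨φ.and ψ, ?_⟩
    ext x
    simp only [Formula.and, Formula.neg, Formula.subst, M.sat_imp, Set.inf_eq_inter,
      Set.mem_inter_iff, Set.mem_ofPred_eq, M.not_sat_fls]
    tauto
  compl_mem' := by
    rintro _ ⟨φ, rfl⟩
    refine ⟨φ.neg, ?_⟩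
    ext x
    simp [Formula.neg, Formula.subst, M.sat_imp, M.not_sat_fls]
  bot_mem' := ⟨.fls, by ext x; simp [Formula.subst, M.not_sat_fls]⟩

instance : ModalAlgebra (M.definable τ) where
  __ := (inferInstance : BooleanAlgebra (M.definable τ))
  dia s := ⟨{x | ∃ y, M.rel x y ∧ y ∈ (s : Set X)}, by
    obtain ⟨_, φ, rfl⟩ := s
    exact ⟨φ.dia, by ext x; simp [Formula.subst, M.sat_dia]⟩⟩
  dia_bot := by ext x; simp
  dia_sup a b := by
    ext x
    simp [and_or_left, exists_or]

/-- The element of the definable algebra given by a formula. -/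
def define (φ : Formula) : M.definable τ := ⟨{x | M.sat x (φ.subst τ)}, φ, rfl⟩

theorem mem_define {φ : Formula} {x : X} :
    x ∈ (M.define τ φ : Set X) ↔ M.sat x (φ.subst τ) := Iff.rfl

theorem define_surjective : Function.Surjective (M.define τ) := by
  rintro ⟨_, φ, rfl⟩
  exact ⟨φ, rfl⟩

theorem eval_define (σ : ℕ → Formula) (φ : Formula) :
    eval (fun n => M.define τ (σ n)) φ = M.define τ (φ.subst σ) := by
  induction φ with
  | var n => rfl
  | fls =>
    refine Subtype.ext (Set.ext fun x => ?_)
    exact (iff_false_intro (M.not_sat_fls x)).symm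
  | imp φ ψ hφ hψ =>
    rw [eval, hφ, hψ]
    ext x
    have : (((M.define τ (φ.subst σ))ᶜ ⊔ M.define τ (ψ.subst σ) : M.definable τ) : Set X) =
      (M.define τ (φ.subst σ) : Set X)ᶜ ∪ (M.define τ (ψ.subst σ) : Set X) := rfl
    rw [this]
    simp only [Formula.subst, Set.mem_union, Set.mem_compl_iff, mem_define, M.sat_imp]
    tauto
  | dia φ hφ =>
    rw [eval, hφ]
    refine Subtype.ext (Set.ext fun x => ?_)
    exact (M.sat_dia x _).symm

theorem define_eq_top_iff {φ : Formula} :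
    M.define τ φ = ⊤ ↔ ∀ x, M.sat x (φ.subst τ) := by
  rw [Subtype.ext_iff]
  exact Set.eq_univ_iff_forall

/-- Elements are definable, so a valuation amounts to a substitution, under which L is closed. -/
theorem isAlgebraOf_definable {L : NormalLogic} (h : ∀ x, ∀ φ ∈ L.carrier, M.sat x φ) :
    IsAlgebraOf (M.definable τ) L := by
  intro φ hφ V
  choose σ hσ using fun n => M.define_surjective τ (V n)
  obtain rfl : (fun n => M.define τ (σ n)) = V := funext hσ
  rw [eval_define, define_eq_top_iff]
  exact fun x => h x _ (L.subst_mem _ _ (L.subst_mem _ _ hφ))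

/-- The submodel of the points reachable from `x₀`. -/
def generated {X : Type} (M : KripkeModel X) (x₀ : X) :
    KripkeModel (ULift.{u} {x // Relation.ReflTransGen M.rel x₀ x}) where
  rel x y := M.rel x.down y.down
  sat x := M.sat x.down
  not_sat_fls x := M.not_sat_fls _
  sat_imp x := M.sat_imp _
  sat_dia x φ := by
    rw [M.sat_dia]
    constructor
    · rintro ⟨y, hy, h⟩
      exact ⟨⟨⟨y, x.down.2.tail hy⟩⟩, hy, h⟩
    · rintro ⟨y, hy, h⟩
      exact ⟨_, hy, h⟩

end KripkeModel

/-! ### Completeness, and finite algebras above the logic of a finite algebra -/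

namespace NormalLogic

open ModalAlgebra KripkeModel

/-- Completeness of a logic with respect to its canonical algebra. -/
theorem exists_algebra_not_validates {L : NormalLogic} {φ : Formula} (h : φ ∉ L.carrier) :
    ∃ (B : Type) (_ : ModalAlgebra B), IsAlgebraOf B L ∧ ¬ Validates B φ := by
  refine ⟨L.canonicalModel.definable .var, inferInstance,
    isAlgebraOf_definable _ _ fun x => x.sat_of_mem, fun hv => ?_⟩
  have := hv fun n => L.canonicalModel.define _ (.var n)
  rw [eval_define, define_eq_top_iff, Formula.subst_var, Formula.subst_var] at this
  obtain ⟨x, hx⟩ := exists_world h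
  exact hx (this x)

theorem _root_.FinModalAlgebra.jankovFormula_mem_or_le (A : FinModalAlgebra.{u}) {m : ℕ}
    (hm : 1 ≤ m) {L : NormalLogic} (hL : preTrans m ≤ L) :
    A.jankovFormula m ∈ L.carrier ∨ L ≤ logicOf A := by
  by_contra! h
  obtain ⟨B, _, hB, hv⟩ := exists_algebra_not_validates h.1
  exact h.2 fun φ hφ =>
    A.validates_of_not_validates_jankovFormula hm (fun ψ hψ => hB ψ (hL hψ)) hv (hB φ hφ)

/-- An extension of the logic of a finite algebra is determined by its finite subdirectly
irreducible algebras. -/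
theorem exists_finite_si_of_logicOf_le {m : ℕ} (hm : 1 ≤ m) {A : Type*} [ModalAlgebra A] [Finite A]
    {L : NormalLogic} (hL : preTrans m ≤ L) (hA : logicOf A ≤ L) {φ : Formula}
    (hφ : φ ∉ L.carrier) :
    ∃ B : FinModalAlgebra.{u}, IsSubdirectlyIrreducible B ∧ IsAlgebraOf B L ∧ ¬ Validates B φ := by
  obtain ⟨x₀, hx₀⟩ := exists_world hφ
  obtain ⟨N, hN⟩ := φ.exists_subst_eq_self
  -- Sending the variables from N on to ⊥ leaves φ unchanged and makes the definable algebra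
  -- N-generated.
  let τ : ℕ → Formula := fun i => if i < N then .var i else .fls
  let M := KripkeModel.generated.{u} L.canonicalModel x₀
  let r : ULift.{u} {x // Relation.ReflTransGen L.canonicalModel.rel x₀ x} := ⟨⟨x₀, .refl⟩⟩
  have hB : IsAlgebraOf (M.definable τ) L := isAlgebraOf_definable _ _ fun x => x.down.1.sat_of_mem
  have hBm : IsAlgebraOf (M.definable τ) (preTrans m) := fun ψ hψ => hB ψ (hL hψ)
  have hfin : Finite (M.definable τ) := by
    choose f hf using M.define_surjective τ
    -- An element goes to the N-ary term function on A of a defining formula. Formulas with equal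
    -- term functions are equivalent in Log A, hence in L.
    refine Finite.of_injective (β := (Fin N → A) → A)
      (fun d U => eval (fun i => if h : i < N then U ⟨i, h⟩ else ⊥) (f d)) fun d d' h => ?_
    have hmem : ((f d).subst τ).iff ((f d').subst τ) ∈ L.carrier := by
      refine hA fun V => top_le_iff.1 ((le_eval_iff_iff _ _ _ _).2 ?_)
      rw [inf_top_eq, inf_top_eq, eval_subst, eval_subst]
      have hV : (fun n => eval V (τ n)) =
          fun i => if h : i < N then (fun j : Fin N => V j) ⟨i, h⟩ else ⊥ := by
        funext i
        by_cases hi : i < N <;> simp [τ, hi, eval]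
      rw [hV]
      exact congrFun h fun j => V j
    rw [← hf d, ← hf d']
    ext x
    exact (x.down.1.sat_iff _ _).1 (x.down.1.sat_of_mem _ hmem)
  -- An open set containing the root r spreads along the relation to every point.
  have hroot : ∀ a : M.definable τ, a ≠ ⊤ → r ∉ (bxLe m a : M.definable τ).1 := by
    intro a ha hr
    refine ha (top_le_iff.1 (le_trans ?_ (bxLe_le m a)))
    have hopen := bxLe_le_bx hm hBm a
    rintro ⟨⟨x, hx⟩⟩ -
    induction hx with
    | refl => exact hr
    | tail hy hyz ih =>
      by_contra hz
      exact hopen ih ⟨⟨⟨_, hy.tail hyz⟩⟩, hyz, hz⟩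
  refine ⟨⟨M.definable τ⟩, ?_, hB, fun hv => ?_⟩
  · have hfin' : Set.Finite {a : M.definable τ | a ≠ ⊤} := Set.toFinite _
    -- The join of all □^{≤m}a with a ≠ ⊤ is a finite union of sets missing the root, so it is not
    -- ⊤.
    refine isSubdirectlyIrreducible_of_opremum (c := hfin'.toFinset.sup (bxLe m)) hm hBm
      (fun h => ?_) fun a ha => Finset.le_sup (f := bxLe m) (by simpa using ha)
    have : r ∉ (hfin'.toFinset.sup (bxLe m)).1 :=
      Finset.sup_induction (p := fun a : M.definable τ => r ∉ a.1) (fun h => h)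
        (fun a ha b hb h => h.elim ha hb) fun a ha => hroot a (by simpa using ha)
    rw [h] at this
    exact this (Set.mem_univ r)
  · have := hv fun n => M.define τ (.var n)
    rw [eval_define, define_eq_top_iff, Formula.subst_var] at this
    have h' := this r
    rw [hN τ fun i hi => by simp [τ, hi]] at h'
    exact hx₀ h'

end NormalLogic

/-! ### Complex algebras and iterated relations -/

/-- The `n`-fold composition of a relation with itself. -/
def relPow {X : Type u} (R : X → X → Prop) : ℕ → X → X → Prop
  | 0 => Eq
  | n + 1 => fun x z => ∃ y, R x y ∧ relPow R n y z

theorem relPow_add {X : Type u} (R : X → X → Prop) (a b : ℕ) (x z : X) :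
    relPow R (a + b) x z ↔ ∃ y, relPow R a x y ∧ relPow R b y z := by
  induction a generalizing x with
  | zero => simp [relPow]
  | succ a ih =>
    rw [Nat.succ_add]
    simp only [relPow, ih]
    constructor
    · rintro ⟨y, h, w, h₁, h₂⟩
      exact ⟨w, ⟨y, h, h₁⟩, h₂⟩
    · rintro ⟨w, ⟨y, h, h₁⟩, h₂⟩
      exact ⟨y, h, w, h₁, h₂⟩

/-- The least relation containing `R` and closed under `(m + 1)`-fold composition into itself. -/
def preTransClosure {X : Type u} (m : ℕ) (R : X → X → Prop) (x y : X) : Prop :=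
  ∃ k, relPow R (1 + k * m) x y

/-- Each closure step is an R-path of length 1 modulo m, and lengths add up. -/
theorem relPow_preTransClosure {X : Type u} {m : ℕ} {R : X → X → Prop} {n : ℕ} {x y : X}
    (h : relPow (preTransClosure m R) n x y) : ∃ k, relPow R (n + k * m) x y := by
  induction n generalizing x with
  | zero => exact ⟨0, by simpa [relPow] using h⟩
  | succ n ih =>
    obtain ⟨z, ⟨k, hk⟩, hz⟩ := h
    obtain ⟨l, hl⟩ := ih hz
    refine ⟨k + l, ?_⟩
    have := (relPow_add R _ _ x y).2 ⟨z, hk, hl⟩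
    rwa [show 1 + k * m + (n + l * m) = n + 1 + (k + l) * m by ring] at this

/-- The complex algebra of a Kripke frame. -/
def ComplexAlgebra {X : Type u} (_ : X → X → Prop) : Type u := Set X

namespace ComplexAlgebra

open ModalAlgebra NormalLogic

variable {X : Type u} {R : X → X → Prop}

instance : ModalAlgebra (ComplexAlgebra R) where
  __ := (inferInstance : BooleanAlgebra (Set X))
  dia s := ({x | ∃ y, R x y ∧ y ∈ (show Set X from s)} : Set X)
  dia_bot := Set.eq_empty_of_forall_notMem fun x ⟨_, _, h⟩ => h
  dia_sup a b := Set.ext fun x => by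
    constructor
    · rintro ⟨y, h, h' | h'⟩
      exacts [.inl ⟨y, h, h'⟩, .inr ⟨y, h, h'⟩]
    · rintro (⟨y, h, h'⟩ | ⟨y, h, h'⟩)
      exacts [⟨y, h, .inl h'⟩, ⟨y, h, .inr h'⟩]

instance [Finite X] : Finite (ComplexAlgebra R) := inferInstanceAs (Finite (Set X))

/-- Membership of a point in an element of the complex algebra. -/
def Holds (x : X) (s : ComplexAlgebra R) : Prop := x ∈ (show Set X from s)

theorem holds_dia {x : X} {s : ComplexAlgebra R} : Holds x (dia s) ↔ ∃ y, R x y ∧ Holds y s :=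
  Iff.rfl

theorem holds_iterate_dia {x : X} {n : ℕ} {s : ComplexAlgebra R} :
    Holds x (dia^[n] s) ↔ ∃ y, relPow R n x y ∧ Holds y s := by
  induction n generalizing x with
  | zero => simp [relPow]
  | succ n ih =>
    rw [Function.iterate_succ_apply', holds_dia]
    simp only [ih, relPow]
    constructor
    · rintro ⟨y, h, z, h₁, h₂⟩
      exact ⟨z, ⟨y, h, h₁⟩, h₂⟩
    · rintro ⟨z, ⟨y, h, h₁⟩, h₂⟩
      exact ⟨y, h, z, h₁, h₂⟩

theorem holds_eval_imp {x : X} {V : ℕ → ComplexAlgebra R} {φ ψ : Formula} :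
    Holds x (eval V (φ.imp ψ)) ↔ (Holds x (eval V φ) → Holds x (eval V ψ)) := by
  have : Holds x (eval V (φ.imp ψ)) ↔ (¬ Holds x (eval V φ) ∨ Holds x (eval V ψ)) := Iff.rfl
  rw [this]
  tauto

theorem preTrans_le_logicOf [Finite X] (m : ℕ) (R : X → X → Prop) :
    preTrans m ≤ logicOf (ComplexAlgebra (preTransClosure m R)) := by
  refine preTrans_le_iff.2 (validates_preTrans_axiom_iff.2 fun s x hx => ?_)
  obtain ⟨y, hy, hs⟩ := holds_iterate_dia.1 hx
  obtain ⟨k, hk⟩ := relPow_preTransClosure hy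
  exact ⟨y, ⟨k + 1, by rwa [show 1 + (k + 1) * m = m + 1 + k * m by ring]⟩, hs⟩

end ComplexAlgebra

/-! ### Filtration -/

namespace Formula

/-- The set of subformulas of a formula. -/
def subformulas : Formula → Set Formula
  | var n => {var n}
  | fls => {fls}
  | imp φ ψ => insert (imp φ ψ) (subformulas φ ∪ subformulas ψ)
  | dia φ => insert (dia φ) (subformulas φ)

theorem finite_subformulas (φ : Formula) : φ.subformulas.Finite := by
  induction φ with
  | var n => exact Set.finite_singleton _
  | fls => exact Set.finite_singleton _
  | imp φ ψ hφ hψ => exact (hφ.union hψ).insert _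
  | dia φ hφ => exact hφ.insert _

theorem self_mem_subformulas (φ : Formula) : φ ∈ φ.subformulas := by
  cases φ <;> simp [subformulas]

end Formula

namespace KripkeModel

open Formula ModalAlgebra ComplexAlgebra

variable {X : Type} (M : KripkeModel X) (m : ℕ) (S : Set Formula)

/-- The formulas `◇ⁱ ψ` with `ψ ∈ S` and `i ≤ m`. -/
def diaClosure : Set Formula := {χ | ∃ ψ ∈ S, ∃ i ≤ m, χ = ψ.diaPow i}

variable {S} in
theorem finite_diaClosure (hS : S.Finite) : (diaClosure m S).Finite := by
  refine ((hS.prod (Set.finite_Iic m)).image fun x => x.1.diaPow x.2).subset ?_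
  rintro _ ⟨ψ, hψ, i, hi, rfl⟩
  exact ⟨(ψ, i), ⟨hψ, hi⟩, rfl⟩

/-- The trace of a point on the formulas `◇ⁱ ψ` with `ψ ∈ S` and `i ≤ m`. -/
def trace (x : X) : Set (diaClosure m S) := {χ | M.sat x χ}

/-- The accessibility relation of the least filtration. -/
def filtrationRel (s t : Set (diaClosure m S)) : Prop :=
  ∃ x y, M.trace m S x = s ∧ M.trace m S y = t ∧ M.rel x y

variable {M m S}

theorem sat_of_trace_eq {x y : X} (h : M.trace m S x = M.trace m S y) {ψ : Formula} (hψ : ψ ∈ S)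
    {i : ℕ} (hi : i ≤ m) (hy : M.sat y (ψ.diaPow i)) : M.sat x (ψ.diaPow i) := by
  have : (⟨_, ψ, hψ, i, hi, rfl⟩ : diaClosure m S) ∈ M.trace m S y := hy
  rw [← h] at this
  exact this

/-- The filtration lives on all sets of formulas, but a path of positive length can end only at a
trace. -/
theorem exists_trace_eq {n : ℕ} {s t : Set (diaClosure m S)}
    (h : relPow (M.filtrationRel m S) (n + 1) s t) : ∃ y, M.trace m S y = t := by
  induction n generalizing s with
  | zero =>
    obtain ⟨_, ⟨x, y, -, hy, -⟩, rfl⟩ := h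
    exact ⟨y, hy⟩
  | succ n ih =>
    obtain ⟨z, -, h⟩ := h
    exact ih h

/-- Each step backwards adds one diamond. While the exponent is at most m the formula stays in
`diaClosure`, so passing between points with the same trace is harmless. -/
theorem sat_diaPow_of_relPow {ψ : Formula} (hψ : ψ ∈ S) {i j : ℕ} (hij : i + j ≤ m) {x y : X}
    (h : relPow (M.filtrationRel m S) j (M.trace m S x) (M.trace m S y))
    (hy : M.sat y (ψ.diaPow i)) : M.sat x (ψ.diaPow (i + j)) := by
  induction j generalizing x with
  | zero => exact sat_of_trace_eq h hψ hij hy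
  | succ j ih =>
    obtain ⟨_, ⟨x', z, hx, rfl, hR⟩, hz⟩ := h
    refine sat_of_trace_eq hx.symm hψ hij ?_
    exact (M.sat_dia _ _).2 ⟨z, hR, ih (by omega) hz⟩

/-- Induction on k handles all but the first m steps and gives ◇ψ there. Going back m - 1 steps
yields ◇^mψ, and one genuine step yields ◇^{m+1}ψ, which the axiom collapses to ◇ψ before the
representative is changed. -/
theorem sat_dia_of_relPow (hm : 1 ≤ m)
    (hM : ∀ x ψ, M.sat x (diaPow (m + 1) ψ) → M.sat x ψ.dia)
    {ψ : Formula} (hψ : ψ ∈ S) {k : ℕ} {x y : X}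
    (h : relPow (M.filtrationRel m S) (1 + k * m) (M.trace m S x) (M.trace m S y))
    (hy : M.sat y ψ) : M.sat x ψ.dia := by
  induction k generalizing x with
  | zero =>
    rw [Nat.zero_mul, Nat.add_zero] at h
    exact sat_diaPow_of_relPow (i := 0) hψ (by omega) h hy
  | succ k ih =>
    rw [show 1 + (k + 1) * m = 1 + (m - 1) + (1 + k * m) by
      rw [Nat.add_sub_of_le hm]; ring] at h
    obtain ⟨_, h₁, h₂⟩ := (relPow_add _ _ _ _ _).1 h
    obtain ⟨w, rfl⟩ := exists_trace_eq (by rwa [Nat.add_comm] at h₁)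
    rw [Nat.add_comm] at h₁
    obtain ⟨_, ⟨x', z, hx, rfl, hR⟩, hz⟩ := h₁
    refine sat_of_trace_eq (i := 1) hx.symm hψ hm (hM _ _ ((M.sat_dia _ _).2 ⟨z, hR, ?_⟩))
    have := sat_diaPow_of_relPow (i := 1) hψ (by omega) hz (ih h₂)
    rwa [Nat.add_sub_of_le hm] at this

variable (M m S) in
/-- The valuation of the filtration. -/
def filtrationValuation (n : ℕ) :
    ComplexAlgebra (preTransClosure m (M.filtrationRel m S)) :=
  ({s | ∃ y, M.trace m S y = s ∧ M.sat y (.var n)} : Set (Set (diaClosure m S)))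

theorem holds_trace_iff (hm : 1 ≤ m)
    (hM : ∀ x ψ, M.sat x (diaPow (m + 1) ψ) → M.sat x ψ.dia) {φ : Formula}
    (hφ : φ.subformulas ⊆ S) (x : X) :
    Holds (M.trace m S x) (eval (M.filtrationValuation m S) φ) ↔ M.sat x φ := by
  induction φ generalizing x with
  | var n =>
    constructor
    · rintro ⟨y, hy, h⟩
      exact sat_of_trace_eq (i := 0) hy.symm (hφ rfl) (Nat.zero_le _) h
    · exact fun h => ⟨x, rfl, h⟩
  | fls => exact iff_of_false (fun h => h) (M.not_sat_fls x)
  | imp φ ψ ihφ ihψ =>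
    rw [holds_eval_imp, M.sat_imp,
      ihφ (subset_trans (fun _ h => .inr (.inl h)) hφ),
      ihψ (subset_trans (fun _ h => .inr (.inr h)) hφ)]
  | dia φ ih =>
    have hφ' : φ.subformulas ⊆ S := subset_trans (fun _ h => .inr h) hφ
    rw [eval, holds_dia]
    constructor
    · rintro ⟨s, ⟨k, hk⟩, hs⟩
      obtain ⟨y, rfl⟩ := exists_trace_eq (by rwa [Nat.add_comm] at hk)
      exact sat_dia_of_relPow hm hM (hφ' φ.self_mem_subformulas) hk ((ih hφ' y).1 hs)
    · intro h
      obtain ⟨y, hR, hy⟩ := (M.sat_dia _ _).1 h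
      refine ⟨M.trace m S y, ⟨0, ?_⟩, (ih hφ' y).2 hy⟩
      rw [Nat.zero_mul]
      exact ⟨_, ⟨x, y, rfl, rfl, hR⟩, rfl⟩

end KripkeModel

/-! ### Finite model property, splittings and union-splittings -/

namespace NormalLogic

open ModalAlgebra KripkeModel ComplexAlgebra

/-- The finite model property of `K4^{m+1}_1`, with respect to subdirectly irreducible algebras. -/
theorem exists_finite_si_of_notMem_preTrans {m : ℕ} (hm : 1 ≤ m) {φ : Formula}
    (hφ : φ ∉ (preTrans m).carrier) :
    ∃ A : FinModalAlgebra.{u}, IsSubdirectlyIrreducible A ∧ IsAlgebraOf A (preTrans m) ∧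
      ¬ Validates A φ := by
  obtain ⟨x, hx⟩ := exists_world hφ
  have hM : ∀ (x : (preTrans m).World) (ψ : Formula),
      x.sat (ψ.diaPow (m + 1)) → x.sat ψ.dia := by
    intro x ψ
    have := x.sat_of_mem _ ((preTrans m).subst_mem (fun _ => ψ) _ (preTrans_le_iff.1 le_rfl))
    rw [Formula.subst, Formula.subst_diaPow, x.sat_imp] at this
    exact this
  have hfin : Finite (diaClosure m φ.subformulas) := finite_diaClosure m φ.finite_subformulas
  have hle := preTrans_le_logicOf m ((preTrans m).canonicalModel.filtrationRel m φ.subformulas)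
  -- The filtration algebra need not be s.i.; taking its own logic as L replaces it by an s.i.
  -- algebra.
  obtain ⟨B, h₁, h₂, h₃⟩ := exists_finite_si_of_logicOf_le.{u} hm hle le_rfl (φ := φ) fun h => by
    refine hx ((holds_trace_iff (M := (preTrans m).canonicalModel) hm hM subset_rfl x).1 ?_)
    rw [h]
    trivial
  exact ⟨B, h₁, fun ψ hψ => h₂ ψ (hle hψ), h₃⟩

/-- Splitting pairs given by Jankov formulas. -/
theorem _root_.FinModalAlgebra.isSplittingPair {m : ℕ} (hm : 1 ≤ m) {A : FinModalAlgebra.{u}}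
    (hsi : IsSubdirectlyIrreducible A) (hA : preTrans m ≤ logicOf A) {L : NExt (preTrans m)}
    (hL : L.logic = (preTrans m).extendBy {A.jankovFormula m}) :
    IsSplittingPair L ⟨logicOf A, hA⟩ := by
  constructor
  · intro h
    have h' : L.logic ≤ logicOf A := h
    rw [hL, extendBy_le_iff, Set.singleton_subset_iff] at h'
    exact A.not_validates_jankovFormula hm hA hsi h'.2
  · intro z
    refine (A.jankovFormula_mem_or_le hm z.2).imp (fun h => ?_) id
    show L.logic ≤ z.logic
    rw [hL, extendBy_le_iff, Set.singleton_subset_iff]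
    exact ⟨z.2, h⟩

/-- Neither left member is below y, so each is below the other. -/
theorem _root_.IsSplittingPair.left_unique {X : Type u} [CompleteLattice X] {x x' y : X}
    (h : IsSplittingPair x y) (h' : IsSplittingPair x' y) : x = x' :=
  le_antisymm ((h.2 x').resolve_right h'.1) ((h'.2 x).resolve_right h.1)

theorem isSplitting_iff {m : ℕ} (hm : 1 ≤ m) (L : NExt (preTrans m)) :
    IsSplitting L ↔ ∃ A : FinModalAlgebra.{u}, IsSubdirectlyIrreducible A ∧
      IsAlgebraOf A (preTrans m) ∧ L.logic = (preTrans m).extendBy {A.jankovFormula m} := by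
  constructor
  · rintro ⟨y, hy⟩
    obtain ⟨φ, hφL, hφ⟩ := Set.not_subset.1 (show ¬ L.logic.carrier ⊆ y.logic.carrier from hy.1)
    obtain ⟨A, hA, hAφ⟩ : ∃ A : FinModalAlgebra.{u}, IsAlgebraOf A (preTrans m) ∧
        ¬ Validates A φ := by
      obtain ⟨A, -, h⟩ := exists_finite_si_of_notMem_preTrans.{u} hm fun h => hφ (y.2 h)
      exact ⟨A, h⟩
    have hAy : logicOf A ≤ y.logic :=
      (hy.2 ⟨logicOf A, hA⟩).resolve_left fun h => hAφ (h hφL)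
    obtain ⟨B, hsi, hB, hBφ⟩ := exists_finite_si_of_logicOf_le.{u} hm y.2 hAy hφ
    have hB' : preTrans m ≤ logicOf B := fun ψ hψ => hB ψ (y.2 hψ)
    -- B is a y-algebra, and it refutes φ ∈ L, so the splitting property forces Log B ≤ y.
    have hBy : y = ⟨logicOf B, hB'⟩ :=
      le_antisymm hB ((hy.2 ⟨logicOf B, hB'⟩).resolve_left fun h => hBφ (h hφL))
    refine ⟨B, hsi, hB', ?_⟩
    let L' : NExt (preTrans m) := ⟨(preTrans m).extendBy {B.jankovFormula m},
      (extendBy_le_iff.1 le_rfl).1⟩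
    have : L = L' := hy.left_unique (hBy ▸ FinModalAlgebra.isSplittingPair hm hsi hB' rfl)
    exact congrArg NExt.logic this
  · rintro ⟨A, hsi, hA, hL⟩
    exact ⟨_, FinModalAlgebra.isSplittingPair hm hsi hA hL⟩

theorem isUnionSplitting_iff {m : ℕ} (hm : 1 ≤ m) (L : NExt (preTrans m)) :
    IsUnionSplitting L ↔ ∃ 𝒜 : Set FinModalAlgebra.{u},
      (∀ A ∈ 𝒜, IsSubdirectlyIrreducible A ∧ IsAlgebraOf A (preTrans m)) ∧
      L.logic = (preTrans m).extendBy {φ | ∃ A ∈ 𝒜, φ = A.jankovFormula m} := by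
  let J : FinModalAlgebra.{u} → NExt (preTrans m) := fun A =>
    ⟨(preTrans m).extendBy {A.jankovFormula m}, (extendBy_le_iff.1 le_rfl).1⟩
  have hJ : ∀ A (z : NExt (preTrans m)), J A ≤ z ↔ A.jankovFormula m ∈ z.logic.carrier := by
    intro A z
    show (preTrans m).extendBy {A.jankovFormula m} ≤ z.logic ↔ _
    rw [extendBy_le_iff, Set.singleton_subset_iff]
    exact and_iff_right z.2
  have hsup : ∀ 𝒜 : Set FinModalAlgebra.{u},
      (sSup (J '' 𝒜)).logic = (preTrans m).extendBy {φ | ∃ A ∈ 𝒜, φ = A.jankovFormula m} := by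
    intro 𝒜
    let E : NExt (preTrans m) := ⟨(preTrans m).extendBy {φ | ∃ A ∈ 𝒜, φ = A.jankovFormula m},
      (extendBy_le_iff.1 le_rfl).1⟩
    refine congrArg NExt.logic (show sSup (J '' 𝒜) = E from ?_)
    refine le_antisymm (sSup_le ?_) (extendBy_le_iff.2 ⟨(sSup (J '' 𝒜)).2, ?_⟩)
    · rintro _ ⟨A, hA, rfl⟩
      exact (hJ A E).2 ((extendBy_le_iff.1 le_rfl).2 ⟨A, hA, rfl⟩)
    · rintro _ ⟨A, hA, rfl⟩
      exact (hJ A _).1 (le_sSup ⟨A, hA, rfl⟩)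
  constructor
  · rintro ⟨S, hS, rfl⟩
    -- Taking every algebra whose Jankov logic lies in S avoids choosing representatives.
    let 𝒜 : Set FinModalAlgebra.{u} :=
      {A | IsSubdirectlyIrreducible A ∧ IsAlgebraOf A (preTrans m) ∧ J A ∈ S}
    refine ⟨𝒜, fun A hA => ⟨hA.1, hA.2.1⟩, ?_⟩
    rw [← hsup]
    congr 2
    refine Set.Subset.antisymm (fun s hs => ?_) (by rintro _ ⟨A, hA, rfl⟩; exact hA.2.2)
    obtain ⟨A, h₁, h₂, h₃⟩ := (isSplitting_iff.{u} hm s).1 (hS s hs)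
    obtain rfl : J A = s := Subtype.ext h₃.symm
    exact ⟨A, ⟨h₁, h₂, hs⟩, rfl⟩
  · rintro ⟨𝒜, h𝒜, hL⟩
    refine ⟨J '' 𝒜, ?_, Subtype.ext (hL.trans (hsup 𝒜).symm)⟩
    rintro _ ⟨A, hA, rfl⟩
    exact (isSplitting_iff.{u} hm _).2 ⟨A, (h𝒜 A hA).1, (h𝒜 A hA).2, rfl⟩

end NormalLogic

theorem mainTheorem5 (m : ℕ) (hm : 1 ≤ m) (L : NExt (NormalLogic.preTrans m)) :
    (IsSplitting L ↔
      ∃ A : FinModalAlgebra.{u},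
        ModalAlgebra.IsSubdirectlyIrreducible A ∧
        ModalAlgebra.IsAlgebraOf A (NormalLogic.preTrans m) ∧
        L.logic = (NormalLogic.preTrans m).extendBy {A.jankovFormula m}) ∧
    (IsUnionSplitting L ↔
      ∃ 𝒜 : Set FinModalAlgebra.{u},
        (∀ A ∈ 𝒜, ModalAlgebra.IsSubdirectlyIrreducible A ∧
          ModalAlgebra.IsAlgebraOf A (NormalLogic.preTrans m)) ∧
        L.logic = (NormalLogic.preTrans m).extendBy
          {φ | ∃ A ∈ 𝒜, φ = A.jankovFormula m}) :=
  ⟨NormalLogic.isSplitting_iff hm L, NormalLogic.isUnionSplitting_iff hm L⟩
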